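/- **Generalized Gap $\geq 2$ Lemma.** A *tangle* is a connected topological space obtained from finitely many disjoint copies of $[0,1]$ by identifying some of their endpoints. A point has degree $k$ if it has an open neighbourhood homeomorphic to $k$ copies of $[0,1)$ glued together at $0$, with the point at the centre; points of degree $\neq 2$ are *singular*, and the *edges* of $\mathcal T$ are the connected components of the set of nonsingular points. A *subtangle* consists of one or more singular points, possibly together with some of the edges joining these points. A *generalized gap $\geq 2$ cutset of cardinality $t$* of a tangle $\mathcal T$ consists of pairwise disjoint sets $X_1,\dots,X_t\subseteq\mathcal T$, each of which is either a single point or a connected subtangle, for which there are at least $t+2$ distinct connected components $C_1,\dots,C_k$ ($k\ge t+2$) of $\mathcal T\setminus\bigcup_i X_i$ such that (a) for all $i,j$ the set $X_i\cap\overline{C_j}$ is empty or a single point (the *contact point* of $X_i$ and $C_j$); (b) each $X_i$ is either of *type I*, i.e. a single point, or of *type II*, i.e. a connected subtangle with more than one point such that exactly three of the $C_j$ have a contact point with $X_i$, these three contact points being distinct; (c) each component $D$ of $\mathcal T\setminus\bigcup_i X_i$ that is not among $C_1,\dots,C_k$ (if there are any) touches at most one type II member, i.e. $X_i\cap\overline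 D\ne\emptyset$ for at most one type II member $X_i$. A *monotone continuous valuation* $\nu$ assigns a real number $\nu(S)\ge 0$ to every connected $S\subseteq\mathcal T$ (the empty set included), with $\nu(\emptyset)=0$ and $\nu(S)\le\nu(S')$ for $S\subseteq S'$, and such that, for every presentation of $\mathcal T$ as a quotient of $m$ copies of $[0,1]$ with some endpoints identified, the value $\nu$ of the set formed by $[x_i,y_i]\cap[0,1]$ in the $i$-th copy, $i=1,\dots,m$, is a continuous function of $(x_1,y_1,\dots,x_m,y_m)\in\mathbb R^{2m}$ on the set of those parameters for which that set is connected. Suppose that the tangle $\mathcal T$ has a generalized gap $\geq 2$ cutset of cardinality $t$. Then for each $n\ge t+1$, $\mathcal T$ does not guarantee connected envy-free allocations for $n$ agents with identical monotone continuous valuations: there is a monotone continuous valuation $\nu$ such that no partition of $\mathcal T$ into $n$ connected (possibly empty) pieces $T_1,\dots,T_n$ satisfies $\nu(T_i)\ge\nu(T_j)$ for all $i,j$. -/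

import Mathlib

namespace TangledCake

open Set

variable {T : Type*} [TopologicalSpace T]

/-! ### Tangles -/

/-- `q` presents `T` as the quotient of `m` disjoint copies of `[0,1]` by an identification of
some of their endpoints. -/
def IsPresentation {m : ℕ} (q : Fin m × unitInterval → T) : Prop :=
  Topology.IsQuotientMap q ∧
    ∀ a b : Fin m × unitInterval, q a = q b →
      a = b ∨ ((a.2 = 0 ∨ a.2 = 1) ∧ (b.2 = 0 ∨ b.2 = 1))

/-- A tangle: a connected space that can be built by taking finitely many disjoint copies of
`[0,1]` and identifying some of their endpoints. -/
def IsTangle (T : Type*) [TopologicalSpace T] : Prop :=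
  ConnectedSpace T ∧ ∃ (m : ℕ) (q : Fin m × unitInterval → T), IsPresentation q

/-- `k` copies of `[0,1)` with all the `0`s identified, realised on the coordinate axes of
`ℝ^k`. -/
def openStar (k : ℕ) : Set (Fin k → ℝ) :=
  {v | (∀ i, 0 ≤ v i ∧ v i < 1) ∧ ∀ i j, i ≠ j → v i = 0 ∨ v j = 0}

/-- The point `x` has degree `k`: some open neighbourhood of `x` looks like `k` copies of `[0,1)`
glued at `0`, with `x` at the centre. -/
def HasDegree (x : T) (k : ℕ) : Prop :=
  ∃ (U : Set T) (hx : x ∈ U) (f : U ≃ₜ openStar k),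
    IsOpen U ∧ (f ⟨x, hx⟩ : Fin k → ℝ) = 0

/-- The singular points of a tangle: those whose degree is not `2` (in a tangle every point has
exactly one degree, and it is at least `1`). -/
def singularSet (T : Type*) [TopologicalSpace T] : Set T :=
  {x | ¬ HasDegree x 2}

/-- `C` is a connected component of the subspace `F`. -/
def IsComponentOf (C F : Set T) : Prop :=
  ∃ x ∈ F, C = connectedComponentIn F x

/-- The edges of a tangle: the connected components left when all singular points are removed. -/
def IsEdge (e : Set T) : Prop :=
  IsComponentOf e (singularSet T)ᶜ

/-- A subtangle: one or more singular points, possibly together with some of the edges joining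
these points (edges all of whose limit points off the edge are among the chosen points). -/
def IsSubtangle (S : Set T) : Prop :=
  ∃ (P : Set T) (E : Set (Set T)),
    P ⊆ singularSet T ∧ P.Nonempty ∧
    (∀ e ∈ E, IsEdge e ∧ closure e ⊆ e ∪ P) ∧
    S = P ∪ ⋃₀ E

/-! ### Generalized gap `≥ 2` cutsets -/

/-- What is left of `T` when all members of the family `X` are deleted. -/
def remainder {t : ℕ} (X : Fin t → Set T) : Set T :=
  (⋃ i, X i)ᶜ

/-- A type I member: a single point. -/
def IsTypeI (S : Set T) : Prop :=
  ∃ p : T, S = {p}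

/-- A type II member, relative to the components `C j`: a connected subtangle with more than one
point, touched by exactly three of the `C j`, no two of which touch it at a common point. -/
def IsTypeII {k : ℕ} (C : Fin k → Set T) (S : Set T) : Prop :=
  S.Nontrivial ∧ IsConnected S ∧ IsSubtangle S ∧
    {j | (S ∩ closure (C j)).Nonempty}.ncard = 3 ∧
    ∀ j j', j ≠ j' → Disjoint (S ∩ closure (C j)) (S ∩ closure (C j'))

/-- `X 0, …, X (t-1)` form a generalized gap `≥ 2` cutset of cardinality `t`, as witnessed by
the pairwise distinct components `C 0, …, C (k-1)` of the complement, where `k ≥ t + 2`. The set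
`X i ∩ closure (C j)` is empty or consists of the contact point of `X i` and `C j`. -/
structure IsGenGapCutsetWith {t k : ℕ} (X : Fin t → Set T) (C : Fin k → Set T) : Prop where
  pairwise_disjoint : ∀ i i', i ≠ i' → Disjoint (X i) (X i')
  card_le : t + 2 ≤ k
  injective : Function.Injective C
  component : ∀ j, IsComponentOf (C j) (remainder X)
  contact : ∀ i j, (X i ∩ closure (C j)).Subsingleton
  types : ∀ i, IsTypeI (X i) ∨ IsTypeII C (X i)
  /-- A component that is not one of the `C j` touches at most one type II member. -/
  other : ∀ D, IsComponentOf D (remainder X) → (∀ j, D ≠ C j) →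
    ∀ i i', (X i).Nontrivial → (X i').Nontrivial →
      (X i ∩ closure D).Nonempty → (X i' ∩ closure D).Nonempty → i = i'

/-- `T` has a generalized gap `≥ 2` cutset of cardinality `t`. -/
def HasGenGapCutset (T : Type*) [TopologicalSpace T] (t : ℕ) : Prop :=
  ∃ (X : Fin t → Set T) (k : ℕ) (C : Fin k → Set T), IsGenGapCutsetWith X C

/-! ### Valuations and allocations -/

/-- The closed set which on the `i`-th copy of `[0,1]` consists of `[x i, y i] ∩ [0,1]`, where
`z = (x, y)`. -/
def segments {m : ℕ} (q : Fin m × unitInterval → T) (z : (Fin m → ℝ) × (Fin m → ℝ)) : Set T :=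
  q '' {a | z.1 a.1 ≤ (a.2 : ℝ) ∧ (a.2 : ℝ) ≤ z.2 a.1}

/-- Monotone continuous valuations. Only the values on connected sets matter; the empty set
counts as connected. -/
structure IsMonotoneContinuous (ν : Set T → ℝ) : Prop where
  nonneg : ∀ S, IsPreconnected S → 0 ≤ ν S
  empty : ν ∅ = 0
  mono : ∀ S S', IsPreconnected S → IsPreconnected S' → S ⊆ S' → ν S ≤ ν S'
  cont : ∀ (m : ℕ) (q : Fin m × unitInterval → T), IsPresentation q →
    ContinuousOn (fun z => ν (segments q z)) {z | IsPreconnected (segments q z)}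

/-- A connected allocation to `n` agents: a partition into `n` connected pieces (a piece may
be empty). -/
structure IsConnectedAllocation {n : ℕ} (A : Fin n → Set T) : Prop where
  connected : ∀ i, IsPreconnected (A i)
  disjoint : ∀ i j, i ≠ j → Disjoint (A i) (A j)
  cover : ⋃ i, A i = univ

/-- No agent values another agent's piece above their own. -/
def IsEnvyFree {n : ℕ} (ν : Fin n → Set T → ℝ) (A : Fin n → Set T) : Prop :=
  ∀ i j, ν i (A j) ≤ ν i (A i)

/-- `T` guarantees connected envy-free allocations for `n` agents with identical monotone
continuous valuations. -/
def GuaranteesIdentical (T : Type*) [TopologicalSpace T] (n : ℕ) : Prop :=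
  ∀ ν : Set T → ℝ, IsMonotoneContinuous ν →
    ∃ A : Fin n → Set T, IsConnectedAllocation A ∧ IsEnvyFree (fun _ => ν) A

end TangledCake

namespace TangledCake

open Set Topology unitInterval MeasureTheory Filter

variable {T : Type*} [TopologicalSpace T]

/-! Write `n = t + 1 + d`. Choose an arc inside every `C j` and spread mass uniformly over each: `t
+ 1` units are shared equally among the `k ≥ t + 2` arcs, and `d` further units go to a single arc.
The total is `n`, so when all agents use this additive valuation, envy-freeness forces every piece
to be worth exactly `1`.

A piece passes through a member `X i` if it contains the point of a type I member, or contact points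
with two of the `C j`. Disjoint pieces cannot pass through the same member
(`not_disjoint_of_passesThrough`), so at most `t` pieces pass through any. A connected piece passing
through none meets at most one `C j` (`eq_of_mem_of_mem`). A `C j` has mass less than `1`, or less
than `d + 1` for the special one, so it can supply at most `0`, respectively `d`, such pieces
(`card_le_of_shares`). This accounts for at most `t + d < n` pieces.

The topological lemmas make this rigorous: members are closed, components of their complement are
open and contain arcs, and length along an arc gives a monotone continuous valuation. -/

/-! ### Topology of tangles -/

/-- The endpoints of `m` disjoint copies of `[0,1]`. -/
def endpoints (m : ℕ) : Set (Fin m × I) :=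
  {a | a.2 = 0 ∨ a.2 = 1}

theorem finite_endpoints (m : ℕ) : (endpoints m).Finite := by
  have h : endpoints m ⊆ (univ : Set (Fin m)) ×ˢ ({0, 1} : Set I) := by
    rintro ⟨i, u⟩ hu
    exact ⟨mem_univ _, by simpa [endpoints] using hu⟩
  exact (finite_univ.prod (toFinite _)).subset h

theorem locallyConnectedSpace_unitInterval : LocallyConnectedSpace I := by
  refine locallyConnectedSpace_iff_connected_subsets.2 fun x U hU => ?_
  exact ⟨ordConnectedComponent U x, ordConnectedComponent_mem_nhds.2 hU,
    (inferInstance : OrdConnected (ordConnectedComponent U x)).isPreconnected,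
    ordConnectedComponent_subset⟩

namespace IsPresentation

variable {m : ℕ} {q : Fin m × I → T}

theorem eq_of_notMem_endpoints (hq : IsPresentation q) {a b : Fin m × I}
    (ha : a ∉ endpoints m) (h : q a = q b) : a = b :=
  (hq.2 a b h).resolve_right fun h' => ha h'.1

theorem preimage_image_subset (hq : IsPresentation q) (K : Set (Fin m × I)) :
    q ⁻¹' (q '' K) ⊆ K ∪ endpoints m := by
  rintro a ⟨b, hb, hba⟩
  by_cases ha : a ∈ endpoints m
  · exact Or.inr ha
  · exact Or.inl (hq.eq_of_notMem_endpoints ha hba.symm ▸ hb)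

/-- Saturating a closed set under `q` adds only endpoints, of which there are finitely many. -/
theorem isClosedMap (hq : IsPresentation q) : IsClosedMap q := by
  intro K hK
  rw [← hq.1.isClosed_preimage]
  have h : q ⁻¹' (q '' K) = K ∪ (q ⁻¹' (q '' K) ∩ endpoints m) := by
    apply Subset.antisymm
    · intro a ha
      exact (hq.preimage_image_subset K ha).imp id fun h => ⟨ha, h⟩
    · exact union_subset (subset_preimage_image _ _) inter_subset_left
  rw [h]
  exact hK.union ((finite_endpoints m).subset inter_subset_right).isClosed

theorem isOpen_image (hq : IsPresentation q) {V : Set (Fin m × I)} (hV : IsOpen V)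
    (hd : Disjoint V (endpoints m)) : IsOpen (q '' V) := by
  rw [← hq.1.isOpen_preimage]
  have h : q ⁻¹' (q '' V) = V := by
    apply Subset.antisymm
    · rintro a ⟨b, hb, hba⟩
      have := hq.eq_of_notMem_endpoints (disjoint_left.1 hd hb) hba
      exact this ▸ hb
    · exact subset_preimage_image _ _
  rwa [h]

theorem t1Space (hq : IsPresentation q) : T1Space T := by
  refine ⟨fun x => ?_⟩
  obtain ⟨a, rfl⟩ := hq.1.surjective x
  rw [← image_singleton]
  exact hq.isClosedMap _ isClosed_singleton

theorem locallyConnectedSpace (hq : IsPresentation q) : LocallyConnectedSpace T :=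
  have := locallyConnectedSpace_unitInterval
  hq.1.isCoinducing.locallyConnectedSpace

end IsPresentation

/-! ### Arcs in the tangle and finiteness of the singular set. -/

/-- A parametrised closed arc in `T`, all of whose open subarcs are open in `T`. -/
structure IsArc (g : I → T) : Prop where
  isClosedEmbedding : IsClosedEmbedding g
  isOpen_image_Ioo : ∀ u v, IsOpen (g '' Ioo u v)

/-- The affine map from `[0,1]` to `[a,b]`. -/
def affine {a b : ℝ} (ha : 0 < a) (hab : a < b) (hb : b < 1) (s : I) : I :=
  ⟨a + s * (b - a), by nlinarith [s.2.1], by nlinarith [s.2.2]⟩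

section affine

variable {a b : ℝ} (ha : 0 < a) (hab : a < b) (hb : b < 1)

theorem coe_affine (s : I) : (affine ha hab hb s : ℝ) = a + s * (b - a) := rfl

theorem strictMono_affine : StrictMono (affine ha hab hb) := by
  intro s t hst
  rw [← Subtype.coe_lt_coe, coe_affine, coe_affine]
  have : (s : ℝ) < t := hst
  nlinarith

theorem continuous_affine : Continuous (affine ha hab hb) := by
  unfold affine
  fun_prop

theorem affine_notMem_endpoints {m : ℕ} (i : Fin m) (s : I) :
    (i, affine ha hab hb s) ∉ endpoints m := by
  have h0 : (0 : ℝ) ≤ s := s.2.1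
  have h1 : (s : ℝ) ≤ 1 := s.2.2
  rintro (h | h)
  · have := congrArg Subtype.val h
    simp only [coe_affine, Icc.coe_zero] at this
    nlinarith
  · have := congrArg Subtype.val h
    simp only [coe_affine, Icc.coe_one] at this
    nlinarith

theorem image_affine_Ioo (u v : I) :
    affine ha hab hb '' Ioo u v = Ioo (affine ha hab hb u) (affine ha hab hb v) := by
  rcases le_total u v with huv | huv
  · refine Subset.antisymm ?_
      (intermediate_value_Ioo huv (continuous_affine ha hab hb).continuousOn)
    rintro _ ⟨s, hs, rfl⟩
    exact ⟨strictMono_affine ha hab hb hs.1, strictMono_affine ha hab hb hs.2⟩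
  · rw [Ioo_eq_empty (not_lt.2 huv), image_empty,
      Ioo_eq_empty (not_lt.2 ((strictMono_affine ha hab hb).monotone huv))]

theorem IsPresentation.isArc {m : ℕ} {q : Fin m × I → T} (hq : IsPresentation q) (i : Fin m) :
    IsArc fun s => q (i, affine ha hab hb s) := by
  have hc : Continuous fun s : I => (i, affine ha hab hb s) :=
    (continuous_const).prodMk (continuous_affine ha hab hb)
  refine ⟨.of_continuous_injective_isClosedMap (hq.1.continuous.comp hc) ?_ ?_, ?_⟩
  · intro s t hst
    have := hq.eq_of_notMem_endpoints (affine_notMem_endpoints ha hab hb i s) hst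
    exact (strictMono_affine ha hab hb).injective (congrArg Prod.snd this)
  · exact hq.isClosedMap.comp hc.isClosedMap
  · intro u v
    have h : (fun s => q (i, affine ha hab hb s)) '' Ioo u v =
        q '' ({i} ×ˢ Ioo (affine ha hab hb u) (affine ha hab hb v)) := by
      rw [← image_affine_Ioo, singleton_prod, image_image, image_image]
    rw [h]
    refine hq.isOpen_image ((isOpen_discrete _).prod isOpen_Ioo) ?_
    rw [← image_affine_Ioo, singleton_prod, image_image]
    rw [disjoint_left]
    rintro _ ⟨s, -, rfl⟩
    exact affine_notMem_endpoints ha hab hb i s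

end affine

theorem IsPresentation.exists_isArc {m : ℕ} {q : Fin m × I → T} (hq : IsPresentation q)
    {U : Set T} (hU : IsOpen U) (hne : U.Nonempty) : ∃ g : I → T, IsArc g ∧ ∀ s, g s ∈ U := by
  obtain ⟨x, hx⟩ := hne
  obtain ⟨⟨i, u⟩, rfl⟩ := hq.1.surjective x
  have hV : IsOpen {v : I | q (i, v) ∈ U} :=
    hU.preimage (hq.1.continuous.comp (continuous_const.prodMk continuous_id))
  obtain ⟨a, b, hab, hsub⟩ := hV.exists_Ioo_subset ⟨u, hx⟩
  obtain ⟨a', ha, hab'⟩ := exists_between hab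
  obtain ⟨b', hab'', hb⟩ := exists_between hab'
  have ha0 : (0 : ℝ) < a' := lt_of_le_of_lt a.2.1 ha
  have hb1 : (b' : ℝ) < 1 := lt_of_lt_of_le hb b.2.2
  have hab3 : (a' : ℝ) < b' := hab''
  refine ⟨_, hq.isArc ha0 hab3 hb1 i, fun s => hsub ⟨?_, ?_⟩⟩
  · refine lt_of_lt_of_le ha (Subtype.coe_le_coe.1 ?_)
    rw [coe_affine]
    nlinarith [s.2.1]
  · refine lt_of_le_of_lt (Subtype.coe_le_coe.1 ?_) hb
    rw [coe_affine]
    nlinarith [s.2.2]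

theorem openStar_two_cases {v : Fin 2 → ℝ} (hv : v ∈ openStar 2) :
    (0 ≤ v 0 ∧ v 0 < 1) ∧ (0 ≤ v 1 ∧ v 1 < 1) ∧ (v 0 = 0 ∨ v 1 = 0) :=
  ⟨hv.1 0, hv.1 1, hv.2 0 1 (by decide)⟩

theorem IsArc.hasDegree_two {g : I → T} (hg : IsArc g) {c : I} (hc : (c : ℝ) = 1 / 2) :
    HasDegree (g c) 2 := by
  -- The two rays unfold to an open interval through `v 0 - v 1`, rescaled so that the centre goes
  -- to `1/2`; `r` refolds it by positive and negative parts.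
  let e : openStar 2 → I := fun v => ⟨(v.1 0 - v.1 1 + 1) / 2, by
    have := openStar_two_cases v.2
    constructor <;> linarith⟩
  let r : I → (Fin 2 → ℝ) := fun s => ![max (2 * s - 1) 0, max (1 - 2 * s) 0]
  have he : Continuous e := by
    have h (j : Fin 2) : Continuous fun v : openStar 2 => v.1 j :=
      (continuous_apply j).comp continuous_subtype_val
    exact Continuous.subtype_mk ((((h 0).sub (h 1)).add_const 1).div_const 2) _
  have hr : Continuous r := by
    refine continuous_pi fun j => ?_
    fin_cases j <;> simp [r] <;> fun_prop
  have hre : r ∘ e = Subtype.val := by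
    funext v
    obtain ⟨h0, h1, h⟩ := openStar_two_cases v.2
    have h2 : 2 * ((v.1 0 - v.1 1 + 1) / 2) - 1 = v.1 0 - v.1 1 := by ring
    have h3 : 1 - 2 * ((v.1 0 - v.1 1 + 1) / 2) = v.1 1 - v.1 0 := by ring
    funext j
    rcases h with h | h <;> fin_cases j <;>
      simp [r, e, -Fin.isValue, h2, h3] <;> simp [h, h0.1, h1.1]
  have hemb : IsEmbedding (g ∘ e) :=
    hg.isClosedEmbedding.isEmbedding.comp (.of_comp he hr (hre ▸ .subtypeVal))
  have hrange : range (g ∘ e) = g '' Ioo 0 1 := by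
    rw [range_comp]
    congr 1
    ext s
    constructor
    · rintro ⟨v, rfl⟩
      obtain ⟨h0, h1, h⟩ := openStar_two_cases v.2
      constructor <;> rw [← Subtype.coe_lt_coe] <;> simp [e] <;> linarith
    · rintro ⟨h0, h1⟩
      rw [← Subtype.coe_lt_coe] at h0 h1
      simp only [Icc.coe_zero, Icc.coe_one] at h0 h1
      refine ⟨⟨r s, ?_, ?_⟩, ?_⟩
      · intro j
        fin_cases j
        · exact ⟨le_max_right _ _, max_lt (by linarith) one_pos⟩
        · exact ⟨le_max_right _ _, max_lt (by linarith) one_pos⟩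
      · intro j j' hj
        have : (s : ℝ) ≤ 1 / 2 ∨ 1 / 2 ≤ (s : ℝ) := le_total _ _
        rcases this with h | h <;> fin_cases j <;> fin_cases j' <;> simp [r] at hj ⊢ <;>
          first
          | (left; linarith)
          | (right; linarith)
      · apply Subtype.ext
        simp only [r, e, Matrix.cons_val_zero, Matrix.cons_val_one]
        rcases le_total (s : ℝ) (1 / 2) with h | h
        · rw [max_eq_right (by linarith), max_eq_left (by linarith)]
          ring
        · rw [max_eq_left (by linarith), max_eq_right (by linarith)]
          ring
  have hzero : (0 : Fin 2 → ℝ) ∈ openStar 2 := ⟨by simp, by simp⟩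
  have hgc : (g ∘ e) ⟨0, hzero⟩ = g c := by
    refine congrArg g (Subtype.ext ?_)
    simp [e, hc]
  refine ⟨range (g ∘ e), ⟨_, hgc⟩, hemb.toHomeomorph.symm, ?_, ?_⟩
  · rw [hrange]
    exact hg.isOpen_image_Ioo 0 1
  · have : (⟨g c, ⟨_, hgc⟩⟩ : range (g ∘ e)) = hemb.toHomeomorph ⟨0, hzero⟩ :=
      Subtype.ext hgc.symm
    rw [this, Homeomorph.symm_apply_apply]

/-- A point that is not the image of an endpoint is the midpoint of a small symmetric arc, hence has
degree 2. -/
theorem IsPresentation.finite_singularSet {m : ℕ} {q : Fin m × I → T} (hq : IsPresentation q) :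
    (singularSet T).Finite := by
  refine ((finite_endpoints m).image q).subset fun x hx => ?_
  obtain ⟨⟨i, u⟩, rfl⟩ := hq.1.surjective x
  by_contra hu
  refine hx ?_
  have hu' : (i, u) ∉ endpoints m := fun h => hu ⟨_, h, rfl⟩
  have h0 : (0 : ℝ) < u :=
    lt_of_le_of_ne u.2.1 fun h => hu' (Or.inl (Subtype.ext h.symm))
  have h1 : (u : ℝ) < 1 := lt_of_le_of_ne u.2.2 fun h => hu' (Or.inr (Subtype.ext h))
  obtain ⟨ε, hε, hε'⟩ := exists_between (lt_min h0 (sub_pos.2 h1))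
  have hl := lt_of_lt_of_le hε' (min_le_left _ _)
  have hr := lt_of_lt_of_le hε' (min_le_right _ _)
  have h := (hq.isArc (a := u - ε) (b := u + ε) (by linarith) (by linarith) (by linarith)
    i).hasDegree_two (c := ⟨1 / 2, by norm_num, by norm_num⟩) rfl
  convert h using 3
  apply Subtype.ext
  rw [coe_affine]
  ring


/-! ### The length of the part of a set that lies on an arc -/

namespace IsArc

variable {g : I → T}

/-- The open subarc and the complement of the closed subarc are disjoint open sets covering
everything but `g u` and `g v`. -/
theorem subset_image_Ioo (hg : IsArc g) {S : Set T} (hS : IsPreconnected S) {u v w : I}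
    (hu : g u ∉ S) (hv : g v ∉ S) (hw : g w ∈ S) (huw : u < w) (hwv : w < v) :
    S ⊆ g '' Ioo u v := by
  have hclosed : IsClosed (g '' Icc u v) := hg.isClosedEmbedding.isClosedMap _ isClosed_Icc
  refine hS.subset_left_of_subset_union (hg.isOpen_image_Ioo u v) hclosed.isOpen_compl ?_ ?_
    ⟨g w, hw, w, ⟨huw, hwv⟩, rfl⟩
  · rw [disjoint_compl_right_iff_subset]
    exact image_mono Ioo_subset_Icc_self
  · intro x hx
    by_cases h : x ∈ g '' Icc u v
    · obtain ⟨s, ⟨h1, h2⟩, rfl⟩ := h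
      refine Or.inl ⟨s, ⟨lt_of_le_of_ne h1 ?_, lt_of_le_of_ne h2 ?_⟩, rfl⟩
      · rintro rfl
        exact hu hx
      · rintro rfl
        exact hv hx
    · exact Or.inr h

/-- A connected set may enter the arc from both ends, so its trace need not be an interval. Then,
however, the complement of the trace is an interval; otherwise `S` is trapped inside the arc and the
trace itself is one. -/
theorem measurableSet_preimage (hg : IsArc g) {S : Set T} (hS : IsPreconnected S) :
    MeasurableSet (g ⁻¹' S) := by
  by_cases hc : (g ⁻¹' S)ᶜ.OrdConnected
  · exact hc.measurableSet.of_compl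
  obtain ⟨u, hu, v, hv, w, hw, hwS⟩ : ∃ u, g u ∉ S ∧ ∃ v, g v ∉ S ∧ ∃ w ∈ Icc u v, g w ∈ S := by
    by_contra! h
    exact hc ⟨fun u hu v hv w hw => h u hu v hv w hw⟩
  have huw : u < w := lt_of_le_of_ne hw.1 (by rintro rfl; exact hu hwS)
  have hwv : w < v := lt_of_le_of_ne hw.2 (by rintro rfl; exact hv hwS)
  have hsub := hg.subset_image_Ioo hS hu hv hwS huw hwv
  have hS' : S ⊆ range g := hsub.trans (image_subset_range _ _)
  have hpre : IsPreconnected (g ⁻¹' S) := by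
    rw [hg.isClosedEmbedding.isInducing.isPreconnected_image.symm, image_preimage_eq_of_subset hS']
    exact hS
  exact hpre.ordConnected.measurableSet

theorem sum_measureReal_preimage (hg : IsArc g) {n : ℕ} {A : Fin n → Set T}
    (hA : IsConnectedAllocation A) : ∑ a, volume.real (g ⁻¹' A a) = 1 := by
  rw [← measureReal_iUnion_fintype, ← preimage_iUnion, hA.cover, preimage_univ, probReal_univ]
  · exact fun a b hab => (hA.disjoint a b hab).preimage g
  · exact fun a => hg.measurableSet_preimage (hA.connected a)

end IsArc

/-! ### Continuity of length, and the valuation built from it. -/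

theorem eventually_le_const_iff {X : Type*} [TopologicalSpace X] {f : X → ℝ} {z : X} {c : ℝ}
    (hf : ContinuousAt f z) (hc : c ≠ f z) : ∀ᶠ y in 𝓝 z, f y ≤ c ↔ f z ≤ c := by
  rcases lt_or_gt_of_ne hc with h | h
  · filter_upwards [hf.eventually (lt_mem_nhds h)] with y hy
    exact iff_of_false (not_le.2 hy) (not_le.2 h)
  · filter_upwards [hf.eventually (gt_mem_nhds h)] with y hy
    exact iff_of_true hy.le h.le

theorem eventually_const_le_iff {X : Type*} [TopologicalSpace X] {f : X → ℝ} {z : X} {c : ℝ}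
    (hf : ContinuousAt f z) (hc : c ≠ f z) : ∀ᶠ y in 𝓝 z, c ≤ f y ↔ c ≤ f z := by
  rcases lt_or_gt_of_ne hc with h | h
  · filter_upwards [hf.eventually (lt_mem_nhds h)] with y hy
    exact iff_of_true hy.le h.le
  · filter_upwards [hf.eventually (gt_mem_nhds h)] with y hy
    exact iff_of_false (not_le.2 hy) (not_le.2 h)

theorem finite_setOf_coe_snd_eq {m : ℕ} (x : Fin m → ℝ) :
    {a : Fin m × I | (a.2 : ℝ) = x a.1}.Finite := by
  refine Finite.of_injOn (f := Prod.fst) (mapsTo_univ _ _) ?_ finite_univ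
  rintro ⟨i, u⟩ hu ⟨j, v⟩ hv (rfl : i = j)
  exact Prod.ext rfl (Subtype.ext (hu.trans hv.symm))

namespace IsPresentation

variable {m : ℕ} {q : Fin m × I → T}

theorem isClosed_segments (hq : IsPresentation q) (z : (Fin m → ℝ) × (Fin m → ℝ)) :
    IsClosed (segments q z) := by
  have h1 : Continuous fun a : Fin m × I => z.1 a.1 :=
    (continuous_of_discreteTopology (f := z.1)).comp continuous_fst
  have h2 : Continuous fun a : Fin m × I => z.2 a.1 :=
    (continuous_of_discreteTopology (f := z.2)).comp continuous_fst
  have h3 : Continuous fun a : Fin m × I => (a.2 : ℝ) := by fun_prop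
  have h : IsClosed ({a : Fin m × I | z.1 a.1 ≤ (a.2 : ℝ)} ∩ {a | (a.2 : ℝ) ≤ z.2 a.1}) :=
    (isClosed_le h1 h3).inter (isClosed_le h3 h2)
  exact hq.isClosedMap _ h

theorem eventually_mem_segments_iff (hq : IsPresentation q) {z : (Fin m → ℝ) × (Fin m → ℝ)}
    {a : Fin m × I} (ha : a ∉ endpoints m) (h1 : (a.2 : ℝ) ≠ z.1 a.1) (h2 : (a.2 : ℝ) ≠ z.2 a.1) :
    ∀ᶠ y in 𝓝 z, q a ∈ segments q y ↔ q a ∈ segments q z := by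
  have hmem (y : (Fin m → ℝ) × (Fin m → ℝ)) :
      q a ∈ segments q y ↔ y.1 a.1 ≤ (a.2 : ℝ) ∧ (a.2 : ℝ) ≤ y.2 a.1 := by
    constructor
    · rintro ⟨b, hb, hba⟩
      rwa [hq.eq_of_notMem_endpoints ha hba.symm]
    · exact fun h => ⟨a, h, rfl⟩
  have hc1 : ContinuousAt (fun y : (Fin m → ℝ) × (Fin m → ℝ) => y.1 a.1) z := by fun_prop
  have hc2 : ContinuousAt (fun y : (Fin m → ℝ) × (Fin m → ℝ) => y.2 a.1) z := by fun_prop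
  filter_upwards [eventually_le_const_iff hc1 h1, eventually_const_le_iff hc2 h2] with y hy1 hy2
  rw [hmem, hmem, hy1, hy2]

/-- For all but finitely many `s`, membership of `g s` in `segments q y` is constant for `y` near
`z`. Indicators thus converge almost everywhere, and on a finite measure space so do the measures.
-/
theorem continuous_measureReal_preimage_segments (hq : IsPresentation q) {g : I → T}
    (hg : IsArc g) : Continuous fun z => volume.real (g ⁻¹' segments q z) := by
  have hmeas (z) : MeasurableSet (g ⁻¹' segments q z) :=
    ((hq.isClosed_segments z).preimage hg.isClosedEmbedding.continuous).measurableSet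
  refine continuous_iff_continuousAt.2 fun z => ?_
  have hfin : (g ⁻¹' (q '' (endpoints m ∪ ({a | (a.2 : ℝ) = z.1 a.1} ∪
      {a | (a.2 : ℝ) = z.2 a.1})))).Finite :=
    (((finite_endpoints m).union ((finite_setOf_coe_snd_eq z.1).union
      (finite_setOf_coe_snd_eq z.2))).image q).preimage hg.isClosedEmbedding.injective.injOn
  refine (ENNReal.tendsto_toReal (measure_ne_top _ _)).comp
    (tendsto_measure_of_ae_tendsto_indicator_of_isFiniteMeasure (𝓝 z) (hmeas z) hmeas ?_)
  filter_upwards [measure_eq_zero_iff_ae_notMem.1 (hfin.measure_zero volume)] with s hs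
  obtain ⟨a, ha⟩ := hq.1.surjective (g s)
  have hnot (h : a ∈ endpoints m ∪ ({a | (a.2 : ℝ) = z.1 a.1} ∪ {a | (a.2 : ℝ) = z.2 a.1})) :
      False := hs ⟨a, h, ha⟩
  have := hq.eventually_mem_segments_iff (z := z) (fun h => hnot (Or.inl h))
    (fun h => hnot (Or.inr (Or.inl h))) (fun h => hnot (Or.inr (Or.inr h)))
  rwa [ha] at this

end IsPresentation

/-- The additive valuation that spreads the mass `w j` uniformly over the arc `g j`. -/
noncomputable def arcValuation {k : ℕ} (w : Fin k → ℝ) (g : Fin k → I → T) (S : Set T) : ℝ :=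
  ∑ j, w j * volume.real (g j ⁻¹' S)

section arcValuation

variable {k : ℕ} {w : Fin k → ℝ} {g : Fin k → I → T}

theorem isMonotoneContinuous_arcValuation (hw : ∀ j, 0 ≤ w j) (hg : ∀ j, IsArc (g j)) :
    IsMonotoneContinuous (arcValuation w g) where
  nonneg _ _ := Finset.sum_nonneg fun j _ => mul_nonneg (hw j) measureReal_nonneg
  empty := by simp [arcValuation]
  mono _ _ _ _ h := Finset.sum_le_sum fun j _ =>
    mul_le_mul_of_nonneg_left (measureReal_mono (preimage_mono h)) (hw j)
  cont _ _ hq := (continuous_finsetSum _ fun j _ => continuous_const.mul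
    (hq.continuous_measureReal_preimage_segments (hg j))).continuousOn

theorem sum_arcValuation (hg : ∀ j, IsArc (g j)) {n : ℕ} {A : Fin n → Set T}
    (hA : IsConnectedAllocation A) : ∑ a, arcValuation w g (A a) = ∑ j, w j := by
  unfold arcValuation
  rw [Finset.sum_comm]
  refine Finset.sum_congr rfl fun j _ => ?_
  rw [← Finset.mul_sum, (hg j).sum_measureReal_preimage hA, mul_one]

end arcValuation


/-! ### Components of open sets -/

namespace IsComponentOf

variable {C D F : Set T}

theorem subset (hC : IsComponentOf C F) : C ⊆ F := by
  obtain ⟨x, -, rfl⟩ := hC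
  exact connectedComponentIn_subset F x

theorem nonempty (hC : IsComponentOf C F) : C.Nonempty := by
  obtain ⟨x, hx, rfl⟩ := hC
  exact ⟨x, mem_connectedComponentIn hx⟩

theorem eq_of_mem (hC : IsComponentOf C F) (hD : IsComponentOf D F) {x : T} (hxC : x ∈ C)
    (hxD : x ∈ D) : C = D := by
  obtain ⟨y, -, rfl⟩ := hC
  obtain ⟨z, -, rfl⟩ := hD
  rw [connectedComponentIn_eq hxC, connectedComponentIn_eq hxD]

theorem isOpen [LocallyConnectedSpace T] (hC : IsComponentOf C F) (hF : IsOpen F) :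
    IsOpen C := by
  obtain ⟨x, -, rfl⟩ := hC
  exact hF.connectedComponentIn

theorem mem_of_mem_closure [LocallyConnectedSpace T] (hC : IsComponentOf C F) (hF : IsOpen F)
    {x : T} (hx : x ∈ closure C) (hxF : x ∈ F) : x ∈ C := by
  obtain ⟨y, hyD, hyC⟩ := mem_closure_iff.1 hx _ hF.connectedComponentIn
    (mem_connectedComponentIn hxF)
  rw [hC.eq_of_mem ⟨x, hxF, rfl⟩ hyC hyD]
  exact mem_connectedComponentIn hxF

end IsComponentOf

/-- Near a point `x` outside the open set `F` and outside the closed set `K`, there are only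
those components of `F` that have a limit point outside `F` and `K`. -/
theorem eventually_component_touches [LocallyConnectedSpace T] {F K : Set T} (hF : IsOpen F)
    (hK : IsClosed K) {x : T} (hxF : x ∉ F) (hxK : x ∉ K) :
    ∀ᶠ y in 𝓝 x, y ∉ K ∧
      ∀ D, IsComponentOf D F → y ∈ D → ∃ p ∈ closure D, p ∉ F ∧ p ∉ K := by
  obtain ⟨N, hN, hNc, hNK⟩ := locallyConnectedSpace_iff_connected_subsets.1 ‹_› x Kᶜ
    (hK.isOpen_compl.mem_nhds hxK)
  filter_upwards [hN] with y hy
  refine ⟨hNK hy, fun D hD hyD => ?_⟩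
  by_contra! h
  -- Otherwise the connected neighbourhood `N` would be covered by `D` and the exterior of `D`,
  -- hence lie in `D`, putting `x` in `F`.
  refine hxF (hD.subset (hNc.subset_left_of_subset_union (hD.isOpen hF)
    isClosed_closure.isOpen_compl (disjoint_compl_right_iff_subset.2 subset_closure) ?_
    ⟨y, hy, hyD⟩ (mem_of_mem_nhds hN)))
  intro z hz
  by_cases hzD : z ∈ closure D
  · by_cases hzF : z ∈ F
    · exact Or.inl (hD.mem_of_mem_closure hF hzD hzF)
    · exact absurd (h z hzD hzF) (hNK hz)
  · exact Or.inr hzD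

/-- The argument is local, so no finiteness of the set of edges is needed. Near a singular limit
point `x` outside `P`, a chosen edge must have `x` in its closure, contrary to the closure
condition; near a nonsingular one, the edge of `x` itself must be chosen. -/
theorem IsSubtangle.isClosed [LocallyConnectedSpace T] [T1Space T]
    (hfin : (singularSet T).Finite) {S : Set T} (hS : IsSubtangle S) : IsClosed S := by
  obtain ⟨P, E, hP, -, hE, rfl⟩ := hS
  have hF : IsOpen (singularSet T)ᶜ := hfin.isClosed.isOpen_compl
  refine isClosed_of_closure_subset fun x hx => ?_
  by_contra hxS
  have hxP : x ∉ P := fun h => hxS (Or.inl h)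
  have hPn : ∀ᶠ y in 𝓝 x, y ∉ P := (hfin.subset hP).isClosed.isOpen_compl.mem_nhds hxP
  by_cases hx' : x ∈ singularSet T
  · have hev := eventually_component_touches hF
      (hfin.subset (sdiff_subset (t := {x}))).isClosed (fun h => h hx') (fun h => h.2 rfl)
    obtain ⟨y, hyS, hyP, -, hy⟩ := ((mem_closure_iff_frequently.1 hx).and_eventually
      (hPn.and hev)).exists
    obtain ⟨e, he, hye⟩ := hyS.resolve_left hyP
    obtain ⟨p, hpe, hp1, hp2⟩ := hy e (hE e he).1 hye
    have hpx : p = x := by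
      by_contra hne
      exact hp2 ⟨not_not.1 hp1, hne⟩
    rcases (hE e he).2 (hpx ▸ hpe) with h | h
    · exact hxS (Or.inr ⟨e, he, h⟩)
    · exact hxP h
  · obtain ⟨y, hyD, hyS⟩ := mem_closure_iff.1 hx _ hF.connectedComponentIn
      (mem_connectedComponentIn hx')
    have hyP : y ∉ P := fun h => connectedComponentIn_subset _ _ hyD (hP h)
    obtain ⟨e, he, hye⟩ := hyS.resolve_left hyP
    have heq := (hE e he).1.eq_of_mem ⟨x, hx', rfl⟩ hye hyD
    exact hxS (Or.inr ⟨e, he, heq ▸ mem_connectedComponentIn hx'⟩)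

/-! ### Connected sets and the members of a cutset. -/

namespace IsGenGapCutsetWith

variable {t k : ℕ} {X : Fin t → Set T} {C : Fin k → Set T}

theorem isClosed [LocallyConnectedSpace T] [T1Space T] (hfin : (singularSet T).Finite)
    (h : IsGenGapCutsetWith X C) (i : Fin t) : IsClosed (X i) := by
  rcases h.types i with ⟨p, hp⟩ | h
  · exact hp ▸ isClosed_singleton
  · exact h.2.2.1.isClosed hfin

theorem isOpen_remainder (hcl : ∀ i, IsClosed (X i)) : IsOpen (remainder X) :=
  (isClosed_iUnion_of_finite hcl).isOpen_compl

/-- A connected set that avoids the one-point members and contains at most one contact point of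
each other member meets at most one of the `C j`. -/
theorem eq_of_mem_of_mem [LocallyConnectedSpace T] (h : IsGenGapCutsetWith X C)
    (hcl : ∀ i, IsClosed (X i)) {S : Set T} (hS : IsPreconnected S)
    (hI : ∀ i, (S ∩ X i).Nonempty → (X i).Nontrivial)
    (hII : ∀ i j j', (S ∩ (X i ∩ closure (C j))).Nonempty →
      (S ∩ (X i ∩ closure (C j'))).Nonempty → j = j')
    {j j' : Fin k} {x y : T} (hxS : x ∈ S) (hyS : y ∈ S) (hx : x ∈ C j) (hy : y ∈ C j') :
    j = j' := by
  have hF := isOpen_remainder hcl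
  have hmem (z : T) : z ∉ remainder X ↔ ∃ i, z ∈ X i := by simp [remainder]
  have huniq {z : T} {i i' : Fin t} (hz : z ∈ X i) (hz' : z ∈ X i') : i = i' := by
    by_contra hne
    exact disjoint_left.1 (h.pairwise_disjoint i i' hne) hz hz'
  -- `W` describes the region reachable from `C j` inside `S`: `C j`, the members at which `S`
  -- contains the contact point with `C j`, and the unlisted components touching these. It is
  -- locally constant on `S`, hence constant, and no other `C l` lies in it.
  let W : T → Prop := fun z => z ∈ C j ∨ ∃ i, (S ∩ (X i ∩ closure (C j))).Nonempty ∧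
    (z ∈ X i ∨ ∃ D, IsComponentOf D (remainder X) ∧ (∀ l, D ≠ C l) ∧
      (X i ∩ closure D).Nonempty ∧ z ∈ D)
  have hW : W x ↔ W y := by
    refine hS.induction₂ (fun x y => W x ↔ W y) ?_ (fun _ _ _ _ _ _ => Iff.trans)
      (fun _ _ _ _ => Iff.symm) hxS hyS
    clear! x y
    intro x hxS
    by_cases hx : x ∈ remainder X
    · refine eventually_nhdsWithin_of_eventually_nhds ?_
      filter_upwards [hF.connectedComponentIn.mem_nhds (mem_connectedComponentIn hx)] with y hy
      have hyF := connectedComponentIn_subset _ _ hy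
      have hD {D : Set T} (hD : IsComponentOf D (remainder X)) : x ∈ D ↔ y ∈ D := by
        constructor
        · intro hxD
          rwa [hD.eq_of_mem ⟨x, hx, rfl⟩ hxD (mem_connectedComponentIn hx)]
        · intro hyD
          rw [hD.eq_of_mem ⟨x, hx, rfl⟩ hyD hy]
          exact mem_connectedComponentIn hx
      have hX (i : Fin t) : x ∈ X i ↔ y ∈ X i :=
        iff_of_false (fun hi => (hmem x).2 ⟨i, hi⟩ hx) (fun hi => (hmem y).2 ⟨i, hi⟩ hyF)
      refine or_congr (hD (h.component j)) (exists_congr fun i => and_congr_right fun _ =>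
        or_congr (hX i) (exists_congr fun D => and_congr_right fun hDc =>
          and_congr_right fun _ => and_congr_right fun _ => hD hDc))
    · obtain ⟨i, hi⟩ := (hmem x).1 hx
      have hnt : (X i).Nontrivial := hI i ⟨x, hxS, hi⟩
      -- Off the closed set `K`, only `X i` and those `C l` having `x` as contact point remain
      -- visible near `x`.
      let K : Set T := (⋃ i' ∈ {i' | i' ≠ i}, X i') ∪ ⋃ l ∈ {l | x ∉ closure (C l)}, closure (C l)
      have hK : IsClosed K :=
        ((toFinite _).isClosed_biUnion fun i' _ => hcl i').union
          ((toFinite _).isClosed_biUnion fun l _ => isClosed_closure)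
      have hKX {z : T} {i' : Fin t} (hz : z ∉ K) (hz' : z ∈ X i') : i' = i := by
        by_contra hne
        exact hz (Or.inl (mem_biUnion (mem_ofPred.2 hne) hz'))
      have hKC {z : T} {l : Fin k} (hz : z ∉ K) (hz' : z ∈ C l) : x ∈ closure (C l) := by
        by_contra hne
        exact hz (Or.inr (mem_biUnion (mem_ofPred.2 hne) (subset_closure hz')))
      have hxK : x ∉ K := by
        rintro (hx' | hx')
        · obtain ⟨i', hne, hi'⟩ := mem_iUnion₂.1 hx'
          exact hne (huniq hi' hi)
        · obtain ⟨l, hl, hl'⟩ := mem_iUnion₂.1 hx'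
          exact hl hl'
      have hWx : W x ↔ (S ∩ (X i ∩ closure (C j))).Nonempty := by
        constructor
        · rintro (hxj | ⟨i', hi', hxi' | ⟨D, hD, -, -, hxD⟩⟩)
          · exact absurd ((h.component j).subset hxj) hx
          · exact huniq hxi' hi ▸ hi'
          · exact absurd (hD.subset hxD) hx
        · exact fun hc => Or.inr ⟨i, hc, Or.inl hi⟩
      filter_upwards [self_mem_nhdsWithin, eventually_nhdsWithin_of_eventually_nhds
        (eventually_component_touches hF hK hx hxK)] with y hyS hy
      obtain ⟨hyK, hyD⟩ := hy
      have htouch {D : Set T} (hD : IsComponentOf D (remainder X)) (hy : y ∈ D) :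
          (X i ∩ closure D).Nonempty := by
        obtain ⟨p, hpD, hpF, hpK⟩ := hyD D hD hy
        obtain ⟨i', hi'⟩ := (hmem p).1 hpF
        exact ⟨p, hKX hpK hi' ▸ hi', hpD⟩
      rw [hWx]
      constructor
      · intro hc
        by_cases hyF : y ∈ remainder X
        · have hDc : IsComponentOf (connectedComponentIn (remainder X) y) (remainder X) :=
            ⟨y, hyF, rfl⟩
          have hyD := mem_connectedComponentIn hyF
          by_cases hl : ∃ l, connectedComponentIn (remainder X) y = C l
          · obtain ⟨l, hl⟩ := hl
            have hxl := hKC hyK (hl ▸ hyD)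
            have hlj := hII i l j ⟨x, hxS, hi, hxl⟩ hc
            exact Or.inl (hlj ▸ hl.subset hyD)
          · exact Or.inr ⟨i, hc, Or.inr ⟨_, hDc, not_exists.1 hl, htouch hDc hyD, hyD⟩⟩
        · obtain ⟨i', hi'⟩ := (hmem y).1 hyF
          exact Or.inr ⟨i, hc, Or.inl (hKX hyK hi' ▸ hi')⟩
      · rintro (hyj | ⟨i', hc, hyi' | ⟨D, hD, hDC, hDi', hyD⟩⟩)
        · exact ⟨x, hxS, hi, hKC hyK hyj⟩
        · exact hKX hyK hyi' ▸ hc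
        -- Condition (c) enters here: both members touched by `D` are nontrivial, so they coincide.
        · have hnt' := hI i' (hc.mono (inter_subset_inter_right _ inter_subset_left))
          exact h.other D hD hDC i' i hnt' hnt hDi' (htouch hD hyD) ▸ hc
  rcases hW.1 (Or.inl hx) with hyj | ⟨i, -, hyi | ⟨D, hD, hDC, -, hyD⟩⟩
  · exact h.injective ((h.component j).eq_of_mem (h.component j') hyj hy)
  · exact absurd ((h.component j').subset hy) ((hmem y).2 ⟨i, hyi⟩)
  · exact absurd (hD.eq_of_mem (h.component j') hyD hy) (hDC j')

end IsGenGapCutsetWith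

/-- `S` passes through the member `X` of a cutset: it contains the point of `X`, if `X` is of
type I, or two contact points of `X`. -/
def PassesThrough {k : ℕ} (C : Fin k → Set T) (X S : Set T) : Prop :=
  ((S ∩ X).Nonempty ∧ ¬ X.Nontrivial) ∨
    ∃ j j', j ≠ j' ∧ (S ∩ (X ∩ closure (C j))).Nonempty ∧ (S ∩ (X ∩ closure (C j'))).Nonempty

theorem PassesThrough.nonempty {k : ℕ} {C : Fin k → Set T} {X S : Set T}
    (h : PassesThrough C X S) : (S ∩ X).Nonempty := by
  rcases h with h | ⟨j, -, -, h, -⟩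
  · exact h.1
  · exact h.mono (inter_subset_inter_right _ inter_subset_left)

namespace IsGenGapCutsetWith

variable {t k : ℕ} {X : Fin t → Set T} {C : Fin k → Set T}

/-- For type II, disjoint `S` and `S'` cannot share a contact point, so they would use four
different `C j` touching `X i`, while only three do. -/
theorem not_disjoint_of_passesThrough (h : IsGenGapCutsetWith X C) {i : Fin t} {S S' : Set T}
    (hS : PassesThrough C (X i) S) (hS' : PassesThrough C (X i) S') : ¬ Disjoint S S' := by
  intro hd
  by_cases hnt : (X i).Nontrivial
  · obtain ⟨a, a', ha, h1, h2⟩ := hS.resolve_left fun h => h.2 hnt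
    obtain ⟨b, b', hb, h3, h4⟩ := hS'.resolve_left fun h => h.2 hnt
    have hne {l l' : Fin k} (hl : (S ∩ (X i ∩ closure (C l))).Nonempty)
        (hl' : (S' ∩ (X i ∩ closure (C l'))).Nonempty) : l ≠ l' := by
      rintro rfl
      obtain ⟨x, hx, hxc⟩ := hl
      obtain ⟨y, hy, hyc⟩ := hl'
      exact disjoint_left.1 hd hx (h.contact i l hxc hyc ▸ hy)
    have hII : IsTypeII C (X i) := (h.types i).resolve_left fun ⟨p, hp⟩ =>
      not_nontrivial_singleton (hp ▸ hnt)
    have hsub : (({a, a', b, b'} : Finset (Fin k)) : Set (Fin k)) ⊆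
        {j | (X i ∩ closure (C j)).Nonempty} := by
      intro l hl
      simp only [Finset.coe_insert, Finset.coe_singleton, mem_insert_iff,
        mem_singleton_iff] at hl
      rcases hl with rfl | rfl | rfl | rfl
      exacts [h1.mono inter_subset_right, h2.mono inter_subset_right,
        h3.mono inter_subset_right, h4.mono inter_subset_right]
    have hcard := ncard_le_ncard hsub (toFinite _)
    rw [hII.2.2.2.1, ncard_coe_finset,
      Finset.card_insert_of_notMem (by simp [ha, hne h1 h3, hne h1 h4]),
      Finset.card_insert_of_notMem (by simp [hne h2 h3, hne h2 h4]), Finset.card_pair hb] at hcard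
    omega
  · obtain ⟨x, hx, hxX⟩ := hS.nonempty
    obtain ⟨y, hy, hyX⟩ := hS'.nonempty
    exact disjoint_left.1 hd hx (not_nontrivial_iff.1 hnt hxX hyX ▸ hy)

end IsGenGapCutsetWith

/-! ### Counting pieces -/

/-- If unit masses on `k` items are split among agents so that each agent gets total value `1`,
then the agents that have a share of only one item number at most `∑ j, b j`, if each weight
`w j` is less than `b j + 1`. -/
theorem card_le_of_shares {α : Type*} {k : ℕ} {w : Fin k → ℝ}
    {s : Fin k → α → ℝ} {G : Finset α} {b : Fin k → ℕ} (hw : ∀ j, 0 ≤ w j)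
    (hb : ∀ j, w j < b j + 1) (hs : ∀ j a, 0 ≤ s j a) (hs1 : ∀ j, ∑ a ∈ G, s j a ≤ 1)
    (hv : ∀ a, ∑ j, w j * s j a = 1)
    (hG : ∀ a ∈ G, ∀ j j', s j a ≠ 0 → s j' a ≠ 0 → j = j') : G.card ≤ ∑ j, b j := by
  classical
  have hex (a : α) : ∃ j, s j a ≠ 0 := by
    by_contra! h
    simpa [h] using hv a
  have hcover : G ⊆ Finset.univ.biUnion fun j => G.filter fun a => s j a ≠ 0 := by
    intro a ha
    obtain ⟨j, hj⟩ := hex a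
    exact Finset.mem_biUnion.2 ⟨j, Finset.mem_univ _, Finset.mem_filter.2 ⟨ha, hj⟩⟩
  refine (Finset.card_le_card hcover).trans (Finset.card_biUnion_le.trans
    (Finset.sum_le_sum fun j _ => ?_))
  -- Agents of `G` with a share of item `j` draw their whole value `1` from it, so their number is
  -- at most `w j`; integrality then improves `< b j + 1` to `≤ b j`.
  have hle : (((G.filter fun a => s j a ≠ 0).card : ℕ) : ℝ) ≤ w j := by
    calc (((G.filter fun a => s j a ≠ 0).card : ℕ) : ℝ)
        = ∑ a ∈ G.filter fun a => s j a ≠ 0, ∑ l, w l * s l a := by simp [hv]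
      _ = ∑ a ∈ G.filter fun a => s j a ≠ 0, w j * s j a := by
          refine Finset.sum_congr rfl fun a ha => ?_
          obtain ⟨haG, haj⟩ := Finset.mem_filter.1 ha
          refine Finset.sum_eq_single j (fun l _ hl => ?_) (by simp)
          by_contra hne
          exact hl (hG a haG l j (right_ne_zero_of_mul hne) haj)
      _ ≤ ∑ a ∈ G, w j * s j a :=
          Finset.sum_le_sum_of_subset_of_nonneg (Finset.filter_subset _ _)
            fun a _ _ => mul_nonneg (hw j) (hs j a)
      _ = w j * ∑ a ∈ G, s j a := (Finset.mul_sum _ _ _).symm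
      _ ≤ w j := mul_le_of_le_one_right (hw j) (hs1 j)
  have := hle.trans_lt (hb j)
  exact Nat.lt_succ_iff.1 (by exact_mod_cast this)

end TangledCake

/-! ### The valuation without envy-free allocation. -/

theorem mainTheorem10 {T : Type*} [TopologicalSpace T] (hT : TangledCake.IsTangle T)
    (t : ℕ) (hX : TangledCake.HasGenGapCutset T t) (n : ℕ) (hn : t + 1 ≤ n) :
    ¬ TangledCake.GuaranteesIdentical T n := by
  classical
  open TangledCake MeasureTheory in
  obtain ⟨-, m, q, hq⟩ := hT
  obtain ⟨X, k, C, hcut⟩ := hX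
  have := hq.t1Space
  have := hq.locallyConnectedSpace
  have hcl := hcut.isClosed hq.finite_singularSet
  have hF := IsGenGapCutsetWith.isOpen_remainder hcl
  have hk := hcut.card_le
  choose g hg hgC using fun j =>
    hq.exists_isArc ((hcut.component j).isOpen hF) (hcut.component j).nonempty
  obtain ⟨d, rfl⟩ := Nat.exists_eq_add_of_le hn
  let b : Fin k → ℕ := fun j => if j = ⟨0, by omega⟩ then d else 0
  -- The equal share `(t + 1) / k` is less than `1` because `k ≥ t + 2`.
  let w : Fin k → ℝ := fun j => b j + (t + 1) / k
  have hk0 : (0 : ℝ) < k := by exact_mod_cast (by omega : 0 < k)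
  have hw : ∀ j, 0 ≤ w j := fun j => by positivity
  have hwb : ∀ j, w j < b j + 1 := by
    intro j
    refine add_lt_add_right ((div_lt_one hk0).2 ?_) _
    exact_mod_cast (by omega : t + 1 < k)
  have hbsum : ∑ j, b j = d := by simp [b]
  have hwsum : ∑ j, w j = (t + 1 + d : ℕ) := by
    have h1 : ∑ j, (b j : ℝ) = d := by exact_mod_cast hbsum
    simp only [w, Finset.sum_add_distrib, h1, Finset.sum_const, Finset.card_univ,
      Fintype.card_fin, nsmul_eq_mul]
    rw [mul_div_cancel₀ _ hk0.ne']
    push_cast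
    ring
  intro hguar
  obtain ⟨A, hA, hEF⟩ := hguar _ (isMonotoneContinuous_arcValuation hw hg)
  -- Identical valuations make all pieces equal in value, and the `t + 1 + d` values sum to `t + 1 +
  -- d`.
  have hval : ∀ a, arcValuation w g (A a) = 1 := by
    intro a
    have hsum := sum_arcValuation (w := w) hg hA
    rw [Finset.sum_congr rfl fun a' _ => le_antisymm (hEF a a') (hEF a' a), hwsum,
      Finset.sum_const, Finset.card_univ, Fintype.card_fin, nsmul_eq_mul] at hsum
    exact mul_left_cancel₀ (Nat.cast_ne_zero.2 (by omega)) (hsum.trans (mul_one _).symm)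
  let B : Finset (Fin (t + 1 + d)) :=
    Finset.univ.filter fun a => ∃ i, PassesThrough C (X i) (A a)
  have hBcard : B.card ≤ t := by
    choose f hf using fun a : B => (Finset.mem_filter.1 a.2).2
    have hinj : Function.Injective f := by
      intro a a' haa'
      by_contra hne
      exact hcut.not_disjoint_of_passesThrough (hf a) (haa' ▸ hf a')
        (hA.disjoint _ _ fun h => hne (Subtype.ext h))
    simpa using Fintype.card_le_of_injective f hinj
  have hGcard : Bᶜ.card ≤ ∑ j, b j := by
    refine card_le_of_shares (s := fun j a => volume.real (g j ⁻¹' A a)) hw hwb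
      (fun _ _ => measureReal_nonneg) (fun j => ?_) hval fun a ha j j' hj hj' => ?_
    · rw [← (hg j).sum_measureReal_preimage hA]
      exact Finset.sum_le_sum_of_subset_of_nonneg (Finset.subset_univ _)
        fun _ _ _ => measureReal_nonneg
    · have hne {l : Fin k} (hl : volume.real (g l ⁻¹' A a) ≠ 0) : ∃ s, g l s ∈ A a := by
        by_contra! h
        refine hl ?_
        rw [Set.eq_empty_of_forall_notMem (s := g l ⁻¹' A a) h, measureReal_empty]
      obtain ⟨s, hs⟩ := hne hj
      obtain ⟨s', hs'⟩ := hne hj'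
      have hnot : ∀ i, ¬ PassesThrough C (X i) (A a) := by simpa [B] using ha
      refine hcut.eq_of_mem_of_mem hcl (hA.connected a) (fun i hi => ?_)
        (fun i l l' hl hl' => ?_) hs hs' (hgC j s) (hgC j' s')
      · by_contra h
        exact hnot i (Or.inl ⟨hi, h⟩)
      · by_contra h
        exact hnot i (Or.inr ⟨l, l', h, hl, hl'⟩)
  rw [Finset.card_compl, Fintype.card_fin, hbsum] at hGcard
  omega
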